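/- Let $n\ge 1$. A \emph{zero pair} of a permutation $\varphi$ of $\{0,1\}^{2n}$ is a pair $(x,y)\in\{0,1\}^n\times\{0,1\}^n$ with $\varphi(x\|0^n)=y\|0^n$. For $\kappa\in\{0,1,\dots,2^n\}$ let $S^\kappa$ denote the set of permutations of $\{0,1\}^{2n}$ with exactly $\kappa$ zero pairs. A quantum distinguisher $\mathcal D^{\varphi,\varphi^{-1}}$ starts in an arbitrary fixed unit vector of the Hilbert space of two $2n$-bit query registers and an arbitrary finite-dimensional workspace. It applies a sequence of unitary gates, measurements (later operations may depend on the outcomes) and oracle gates $O^{\varphi}$, $O^{\varphi^{-1}}$, where $O^{f}\,|x\rangle|y\rangle=|x\rangle|y\oplus f(x)\rangle$, and finally outputs a bit. The initial state, the gates and the measurements may depend on $n$ but not on $\varphi$. Each use of $O^{\varphi}$ or of $O^{\varphi^{-1}}$ counts as one query. \textbf{Theorem.} Let $n\ge 1$, $\kappa\in\{0,1,\dots,2^n\}$ and $T\ge 0$. For every quantum distinguisher $\mathcal D$ which makes at most $T$ queries, $$\Big|\Pr_{\varphi\sim S^\kappa}\big[\mathcal D^{\varphi,\varphi^{-1}}=1\big]-\Pr_{\varphi\sim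 S^0}\big[\mathcal D^{\varphi,\varphi^{-1}}=1\big]\Big|\;\le\;2T\sqrt{\frac{\kappa}{2^n}},$$ where $\varphi$ is drawn uniformly at random from $S^\kappa$ and from $S^0$, respectively, and the probabilities are also over the measurement outcomes of $\mathcal D$. -/

import Mathlib

/-- Bit strings of length `m`. The bits `0, 1` are the elements of `ZMod 2`, so that `+` on
`BitString m` is the bitwise exclusive or, and `0` is the string `0 ... 0`. -/
abbrev BitString (m : ℕ) : Type := Fin m → ZMod 2

/-- The number of zero pairs of a permutation `φ` of the `2n`-bit strings: the number of pairs
`(x, y)` of `n`-bit strings such that `φ (x || 0^n) = y || 0^n`. -/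
def numZeroPairs {n : ℕ} (φ : Equiv.Perm (BitString (n + n))) : ℕ :=
  (Finset.univ.filter fun p : BitString n × BitString n =>
    φ (Fin.append p.1 (0 : BitString n)) = Fin.append p.2 (0 : BitString n)).card

/-- The set of all permutations of the `2n`-bit strings with exactly `κ` zero pairs. -/
def permsWithZeroPairs (n κ : ℕ) : Finset (Equiv.Perm (BitString (n + n))) :=
  Finset.univ.filter fun φ => numZeroPairs φ = κ

/-- Labels of the computational basis: a `2n`-bit query input register, a `2n`-bit query output
register, and a workspace with basis labels `E`. -/
abbrev Reg (n : ℕ) (E : Type*) : Type _ := BitString (n + n) × BitString (n + n) × E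

/-- The state space of the algorithm: the tensor product of the three registers, as the
Hilbert space with orthonormal basis `Reg n E`. -/
abbrev StateSpace (n : ℕ) (E : Type*) : Type _ := EuclideanSpace ℂ (Reg n E)

/-- The permutation `(x, y, e) ↦ (x, y ⊕ f x, e)` of the basis labels. -/
def queryEquiv {n : ℕ} {E : Type*} (f : BitString (n + n) → BitString (n + n)) :
    Reg n E ≃ Reg n E where
  toFun r := (r.1, r.2.1 + f r.1, r.2.2)
  invFun r := (r.1, r.2.1 - f r.1, r.2.2)
  left_inv r := by simp
  right_inv r := by simp

/-- The oracle unitary of `f`: `|x⟩ |y⟩ |e⟩ ↦ |x⟩ |y ⊕ f x⟩ |e⟩`. -/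
noncomputable def queryUnitary {n : ℕ} {E : Type*} [Fintype E]
    (f : BitString (n + n) → BitString (n + n)) :
    StateSpace n E ≃ₗᵢ[ℂ] StateSpace n E :=
  LinearIsometryEquiv.piLpCongrLeft 2 ℂ ℂ (queryEquiv f)

/-- A quantum circuit with two oracle gates, one for a permutation and one for its inverse.
It consists of unitary gates, of measurements (given by measurement operators `M o` with
`∑ o, (M o)† (M o) = 1`), after which the circuit may continue depending on the outcome, and of
oracle gates. It ends by outputting a bit. -/
inductive OracleCircuit (n : ℕ) (E : Type*) [Fintype E] : Type _
  | output (b : Bool) : OracleCircuit n E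
  | gate (U : StateSpace n E ≃ₗᵢ[ℂ] StateSpace n E) (next : OracleCircuit n E) :
      OracleCircuit n E
  | measure (k : ℕ) (M : Fin k → StateSpace n E →L[ℂ] StateSpace n E)
      (hM : ∑ o, (ContinuousLinearMap.adjoint (M o)).comp (M o) =
        ContinuousLinearMap.id ℂ (StateSpace n E))
      (next : Fin k → OracleCircuit n E) : OracleCircuit n E
  | queryForward (next : OracleCircuit n E) : OracleCircuit n E
  | queryInverse (next : OracleCircuit n E) : OracleCircuit n E

namespace OracleCircuit

/-- The number of oracle gates (forward and inverse together), in the worst case over the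
measurement outcomes. -/
def queryCount {n : ℕ} {E : Type*} [Fintype E] : OracleCircuit n E → ℕ
  | output _ => 0
  | gate _ next => next.queryCount
  | measure _ _ _ next => Finset.univ.sup fun o => (next o).queryCount
  | queryForward next => next.queryCount + 1
  | queryInverse next => next.queryCount + 1

/-- The probability that the circuit with oracles `φ` and `φ⁻¹` outputs `1`, as a function of the
current state `ψ`. States after a measurement are not renormalised: the squared norm of `ψ` is
the probability that the current branch has been reached. -/
noncomputable def outputOneProb {n : ℕ} {E : Type*} [Fintype E]
    (φ : Equiv.Perm (BitString (n + n))) : OracleCircuit n E → StateSpace n E → ℝ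
  | output b, ψ => if b then ‖ψ‖ ^ 2 else 0
  | gate U next, ψ => next.outputOneProb φ (U ψ)
  | measure _ M _ next, ψ => ∑ o, (next o).outputOneProb φ (M o ψ)
  | queryForward next, ψ => next.outputOneProb φ (queryUnitary φ ψ)
  | queryInverse next, ψ => next.outputOneProb φ (queryUnitary φ.symm ψ)

end OracleCircuit

/-- A distinguisher on `2n`-bit permutations: a normalised initial state, and a quantum circuit
with oracle gates for the permutation and for its inverse. -/
structure Distinguisher (n : ℕ) (E : Type*) [Fintype E] where
  init : StateSpace n E
  norm_init : ‖init‖ = 1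
  circuit : OracleCircuit n E

/-- `D` makes at most `T` queries. -/
def Distinguisher.MakesAtMost {n : ℕ} {E : Type*} [Fintype E] (D : Distinguisher n E)
    (T : ℕ) : Prop :=
  D.circuit.queryCount ≤ T

/-- The probability that `D`, run with oracles `φ` and `φ⁻¹`, outputs `1`. -/
noncomputable def Distinguisher.prob {n : ℕ} {E : Type*} [Fintype E] (D : Distinguisher n E)
    (φ : Equiv.Perm (BitString (n + n))) : ℝ :=
  D.circuit.outputOneProb φ D.init

/-- The probability that `D`, run with oracles `φ` and `φ⁻¹`, outputs `1` when `φ` is uniformly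
random among the permutations with exactly `κ` zero pairs. -/
noncomputable def Distinguisher.avgProb {n : ℕ} {E : Type*} [Fintype E] (D : Distinguisher n E)
    (κ : ℕ) : ℝ :=
  (∑ φ ∈ permsWithZeroPairs n κ, D.prob φ) / ((permsWithZeroPairs n κ).card : ℝ)

/-! The two distributions are coupled. Take φ without zero pairs, let Z be the zero block and choose
κ points of Z and κ points of φ⁻¹(Z), matched up at random. Let π exchange partners. Then φ ∘ π has
exactly κ zero pairs. Conversely, a permutation with κ zero pairs arises from a number of choices
that depends only on n and κ, so a uniform φ yields a uniform φ ∘ π (`mul_exchange_mem_iff`,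
`sum_sum_mul_exchange`).

For fixed φ, symmetry shows that π moves any given point with probability at most δ² = κ/2^n
(`card_sumEmbeddings_hit_le`). So both oracles change at any given point with probability at most
δ². A hybrid argument over the queries then costs 2δ per query (`sum_abs_outputOneProb_sub_le`):
each comparison is made on a state produced by φ alone, hence independent of π. -/

namespace OracleCircuit

/-! ### Continuity of the acceptance probability in the state -/

variable {n : ℕ} {E : Type*} [Fintype E]

lemma sum_norm_sq_measurement {k : ℕ} {M : Fin k → StateSpace n E →L[ℂ] StateSpace n E}
    (hM : ∑ o, (ContinuousLinearMap.adjoint (M o)).comp (M o) =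
      ContinuousLinearMap.id ℂ (StateSpace n E)) (ψ : StateSpace n E) :
    ∑ o, ‖M o ψ‖ ^ 2 = ‖ψ‖ ^ 2 := by
  have h : ∀ o, ‖M o ψ‖ ^ 2 =
      RCLike.re (inner ℂ ((ContinuousLinearMap.adjoint (M o)).comp (M o) ψ) ψ) := fun o => by
    rw [ContinuousLinearMap.comp_apply, ContinuousLinearMap.adjoint_inner_left,
      ← norm_sq_eq_re_inner]
  simp_rw [h]
  rw [← map_sum, ← sum_inner, ← sum_apply, hM,
    ContinuousLinearMap.id_apply, ← norm_sq_eq_re_inner]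

/-- The acceptance probability is a quadratic form with values between `0` and the squared norm;
this is the resulting continuity estimate. -/
lemma abs_two_mul_outputOneProb_sub_le (φ : Equiv.Perm (BitString (n + n)))
    (C : OracleCircuit n E) (ψ χ : StateSpace n E) :
    |2 * (C.outputOneProb φ ψ - C.outputOneProb φ χ) - (‖ψ‖ ^ 2 - ‖χ‖ ^ 2)| ≤
      ‖ψ - χ‖ * ‖ψ + χ‖ := by
  induction C generalizing ψ χ with
  | output b =>
    have key : |‖ψ‖ ^ 2 - ‖χ‖ ^ 2| ≤ ‖ψ - χ‖ * ‖ψ + χ‖ := by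
      -- The cross terms ⟨ψ, χ⟩ - ⟨χ, ψ⟩ are purely imaginary.
      have h : ‖ψ‖ ^ 2 - ‖χ‖ ^ 2 = RCLike.re (inner ℂ (ψ - χ) (ψ + χ)) := by
        rw [inner_sub_left, inner_add_right, inner_add_right, norm_sq_eq_re_inner (𝕜 := ℂ) ψ,
          norm_sq_eq_re_inner (𝕜 := ℂ) χ]
        simp only [map_sub, map_add]
        rw [inner_re_symm (𝕜 := ℂ) ψ χ]
        ring
      rw [h]
      exact (RCLike.abs_re_le_norm _).trans (norm_inner_le_norm _ _)
    cases b with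
    | true =>
      simp only [outputOneProb, if_true]
      rwa [two_mul, add_sub_cancel_right]
    | false =>
      simp only [outputOneProb, Bool.false_eq_true, if_false]
      rwa [sub_zero, mul_zero, zero_sub, abs_neg]
  | gate U next ih =>
    simpa only [outputOneProb, ← map_sub, ← map_add, LinearIsometryEquiv.norm_map] using
      ih (U ψ) (U χ)
  | measure k M hM next ih =>
    simp only [outputOneProb]
    rw [← sum_norm_sq_measurement hM ψ, ← sum_norm_sq_measurement hM χ,
      ← Finset.sum_sub_distrib, ← Finset.sum_sub_distrib, Finset.mul_sum,
      ← Finset.sum_sub_distrib]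
    refine (Finset.abs_sum_le_sum_abs _ _).trans
      ((Finset.sum_le_sum fun o _ => ih o (M o ψ) (M o χ)).trans ?_)
    simp only [← map_sub, ← map_add]
    -- Cauchy–Schwarz over the outcomes; a measurement preserves the total squared norm of both ψ -
    -- χ and ψ + χ.
    refine (Real.sum_mul_le_sqrt_mul_sqrt _ _ _).trans ?_
    rw [sum_norm_sq_measurement hM, sum_norm_sq_measurement hM,
      Real.sqrt_sq (norm_nonneg _), Real.sqrt_sq (norm_nonneg _)]
  | queryForward next ih =>
    simpa only [outputOneProb, ← map_sub, ← map_add, LinearIsometryEquiv.norm_map] using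
      ih (queryUnitary φ ψ) (queryUnitary φ χ)
  | queryInverse next ih =>
    simpa only [outputOneProb, ← map_sub, ← map_add, LinearIsometryEquiv.norm_map] using
      ih (queryUnitary φ.symm ψ) (queryUnitary φ.symm χ)

/-- Subtracting half the squared norm centres the quadratic form. This saves a factor 2 over the
naive bound, and the final constant 2 relies on it. -/
lemma abs_outputOneProb_sub_le (φ : Equiv.Perm (BitString (n + n)))
    (C : OracleCircuit n E) {ψ χ : StateSpace n E} {r : ℝ} (hψ : ‖ψ‖ = r) (hχ : ‖χ‖ = r) :
    |C.outputOneProb φ ψ - C.outputOneProb φ χ| ≤ ‖ψ - χ‖ * r := by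
  have h := C.abs_two_mul_outputOneProb_sub_le φ ψ χ
  rw [hψ, hχ, sub_self, sub_zero, abs_mul, abs_two] at h
  have h' : ‖ψ + χ‖ ≤ 2 * r := (norm_add_le _ _).trans_eq (by rw [hψ, hχ]; ring)
  nlinarith [mul_le_mul_of_nonneg_left h' (norm_nonneg (ψ - χ))]

/-! ### The hybrid argument -/

lemma queryUnitary_apply (f : BitString (n + n) → BitString (n + n)) (ψ : StateSpace n E)
    (r : Reg n E) : queryUnitary f ψ r = ψ (r.1, r.2.1 - f r.1, r.2.2) := rfl

/-- The images agree where f = g. Elsewhere |u - v|² ≤ 2|u|² + 2|v|², and a query fixes the input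
register, so it preserves the mass on the inputs with f ≠ g. -/
lemma norm_queryUnitary_sub_sq_le (f g : BitString (n + n) → BitString (n + n))
    (ψ : StateSpace n E) :
    ‖queryUnitary f ψ - queryUnitary g ψ‖ ^ 2 ≤
      4 * ∑ r : Reg n E, if f r.1 ≠ g r.1 then ‖ψ r‖ ^ 2 else 0 := by
  have hsum : ∀ h : BitString (n + n) → BitString (n + n),
      (∑ r : Reg n E, if f r.1 ≠ g r.1 then ‖queryUnitary h ψ r‖ ^ 2 else 0) =
        ∑ r : Reg n E, if f r.1 ≠ g r.1 then ‖ψ r‖ ^ 2 else 0 := fun h =>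
    Equiv.sum_comp (queryEquiv h).symm
      (fun r : Reg n E => if f r.1 ≠ g r.1 then ‖ψ r‖ ^ 2 else 0)
  rw [EuclideanSpace.norm_sq_eq]
  calc ∑ r, ‖(queryUnitary f ψ - queryUnitary g ψ) r‖ ^ 2
      ≤ ∑ r : Reg n E, (2 * (if f r.1 ≠ g r.1 then ‖queryUnitary f ψ r‖ ^ 2 else 0) +
          2 * (if f r.1 ≠ g r.1 then ‖queryUnitary g ψ r‖ ^ 2 else 0)) := by
        refine Finset.sum_le_sum fun r _ => ?_
        rw [PiLp.sub_apply]
        split_ifs with h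
        · nlinarith [norm_sub_le (queryUnitary f ψ r) (queryUnitary g ψ r),
            norm_nonneg (queryUnitary f ψ r - queryUnitary g ψ r),
            sq_nonneg (‖queryUnitary f ψ r‖ - ‖queryUnitary g ψ r‖)]
        · rw [queryUnitary_apply, queryUnitary_apply, not_not.1 h]
          simp
    _ = _ := by
        rw [Finset.sum_add_distrib, ← Finset.mul_sum, ← Finset.mul_sum, hsum f, hsum g]
        ring

/-- If a random oracle `g i` differs from `f` at each given point with probability at most `δ²`,
then on average a query to `g i` and a query to `f` give states at distance at most `2δ`. -/
lemma sum_norm_queryUnitary_sub_le {ι : Type*} (s : Finset ι)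
    (g : ι → BitString (n + n) → BitString (n + n)) (f : BitString (n + n) → BitString (n + n))
    {δ : ℝ} (hδ : 0 ≤ δ)
    (h : ∀ a, ((s.filter fun i => g i a ≠ f a).card : ℝ) ≤ δ ^ 2 * s.card)
    (ψ : StateSpace n E) :
    ∑ i ∈ s, ‖queryUnitary (g i) ψ - queryUnitary f ψ‖ ≤ 2 * δ * s.card * ‖ψ‖ := by
  have hsq : ∑ i ∈ s, ‖queryUnitary (g i) ψ - queryUnitary f ψ‖ ^ 2 ≤
      4 * (δ ^ 2 * s.card * ‖ψ‖ ^ 2) := by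
    refine (Finset.sum_le_sum fun i _ => norm_queryUnitary_sub_sq_le (g i) f ψ).trans ?_
    -- Since ψ does not depend on i, each basis label contributes its weight times the number of i
    -- whose oracle differs there.
    rw [← Finset.mul_sum, Finset.sum_comm, EuclideanSpace.norm_sq_eq,
      Finset.mul_sum _ _ (δ ^ 2 * s.card)]
    refine mul_le_mul_of_nonneg_left (Finset.sum_le_sum fun r _ => ?_) (by norm_num)
    rw [← Finset.sum_filter, Finset.sum_const, nsmul_eq_mul]
    exact mul_le_mul_of_nonneg_right (h r.1) (sq_nonneg _)
  refine (sq_le_sq₀ (Finset.sum_nonneg fun i _ => norm_nonneg _) (by positivity)).1 ?_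
  calc (∑ i ∈ s, ‖queryUnitary (g i) ψ - queryUnitary f ψ‖) ^ 2
      ≤ s.card * ∑ i ∈ s, ‖queryUnitary (g i) ψ - queryUnitary f ψ‖ ^ 2 :=
        sq_sum_le_card_mul_sum_sq
    _ ≤ s.card * (4 * (δ ^ 2 * s.card * ‖ψ‖ ^ 2)) :=
        mul_le_mul_of_nonneg_left hsq (Nat.cast_nonneg _)
    _ = _ := by ring

/-- Replacing the forward or the inverse oracle in the first query and in the rest of the
circuit. -/
lemma sum_abs_outputOneProb_query_sub_le {ι : Type*} (s : Finset ι)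
    (σ : ι → Equiv.Perm (BitString (n + n))) (φ : Equiv.Perm (BitString (n + n)))
    (g : ι → BitString (n + n) → BitString (n + n)) (f : BitString (n + n) → BitString (n + n))
    {δ : ℝ} (hδ : 0 ≤ δ)
    (h : ∀ a, ((s.filter fun i => g i a ≠ f a).card : ℝ) ≤ δ ^ 2 * s.card)
    (C : OracleCircuit n E) {q : ℕ} (ψ : StateSpace n E)
    (hC : ∑ i ∈ s, |C.outputOneProb (σ i) (queryUnitary f ψ) -
      C.outputOneProb φ (queryUnitary f ψ)| ≤ 2 * δ * s.card * q * ‖queryUnitary f ψ‖ ^ 2) :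
    ∑ i ∈ s, |C.outputOneProb (σ i) (queryUnitary (g i) ψ) -
      C.outputOneProb φ (queryUnitary f ψ)| ≤ 2 * δ * s.card * (q + 1 : ℕ) * ‖ψ‖ ^ 2 := by
  rw [LinearIsometryEquiv.norm_map] at hC
  -- The hybrid answers the first query with f and all later ones with `σ i`.
  have hstep : ∀ i ∈ s, |C.outputOneProb (σ i) (queryUnitary (g i) ψ) -
      C.outputOneProb φ (queryUnitary f ψ)| ≤
      ‖queryUnitary (g i) ψ - queryUnitary f ψ‖ * ‖ψ‖ +
      |C.outputOneProb (σ i) (queryUnitary f ψ) - C.outputOneProb φ (queryUnitary f ψ)| :=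
    fun i _ => (abs_sub_le _ (C.outputOneProb (σ i) (queryUnitary f ψ)) _).trans
      (add_le_add_left (C.abs_outputOneProb_sub_le (σ i) (LinearIsometryEquiv.norm_map _ _)
        (LinearIsometryEquiv.norm_map _ _)) _)
  refine (Finset.sum_le_sum hstep).trans ?_
  rw [Finset.sum_add_distrib, ← Finset.sum_mul]
  refine (add_le_add (mul_le_mul_of_nonneg_right (sum_norm_queryUnitary_sub_le s g f hδ h ψ)
    (norm_nonneg ψ)) hC).trans_eq ?_
  push_cast
  ring

/-- If a random permutation `σ i` differs from `φ` at each given point, and its inverse differs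
from `φ⁻¹` at each given point, with probability at most `δ²`, then `q` queries change the
acceptance probability by at most `2qδ` on average. -/
lemma sum_abs_outputOneProb_sub_le {ι : Type*} (s : Finset ι)
    (σ : ι → Equiv.Perm (BitString (n + n))) (φ : Equiv.Perm (BitString (n + n)))
    {δ : ℝ} (hδ : 0 ≤ δ)
    (hfwd : ∀ a, ((s.filter fun i => σ i a ≠ φ a).card : ℝ) ≤ δ ^ 2 * s.card)
    (hinv : ∀ a, ((s.filter fun i => (σ i).symm a ≠ φ.symm a).card : ℝ) ≤ δ ^ 2 * s.card)
    (C : OracleCircuit n E) (ψ : StateSpace n E) :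
    ∑ i ∈ s, |C.outputOneProb (σ i) ψ - C.outputOneProb φ ψ| ≤
      2 * δ * s.card * C.queryCount * ‖ψ‖ ^ 2 := by
  induction C generalizing ψ with
  | output b => simp [outputOneProb, queryCount]
  | gate U next ih =>
    have h := ih (U ψ)
    rwa [LinearIsometryEquiv.norm_map] at h
  | measure k M hM next ih =>
    simp only [outputOneProb, queryCount]
    calc ∑ i ∈ s, |∑ o, (next o).outputOneProb (σ i) (M o ψ) -
          ∑ o, (next o).outputOneProb φ (M o ψ)|
        ≤ ∑ i ∈ s, ∑ o, |(next o).outputOneProb (σ i) (M o ψ) -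
          (next o).outputOneProb φ (M o ψ)| := Finset.sum_le_sum fun i _ => by
          rw [← Finset.sum_sub_distrib]
          exact Finset.abs_sum_le_sum_abs _ _
      _ = ∑ o, ∑ i ∈ s, |(next o).outputOneProb (σ i) (M o ψ) -
          (next o).outputOneProb φ (M o ψ)| := Finset.sum_comm
      _ ≤ ∑ o, 2 * δ * s.card * (Finset.univ.sup fun o => (next o).queryCount : ℕ) *
          ‖M o ψ‖ ^ 2 := Finset.sum_le_sum fun o _ => (ih o (M o ψ)).trans (by
            have : (next o).queryCount ≤ Finset.univ.sup fun o => (next o).queryCount :=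
              Finset.le_sup (f := fun o => (next o).queryCount) (Finset.mem_univ o)
            gcongr)
      _ = _ := by rw [← Finset.mul_sum, sum_norm_sq_measurement hM]
  | queryForward next ih =>
    exact sum_abs_outputOneProb_query_sub_le s σ φ (fun i => σ i) φ hδ hfwd next ψ (ih _)
  | queryInverse next ih =>
    exact sum_abs_outputOneProb_query_sub_le s σ φ (fun i => (σ i).symm) φ.symm hδ hinv next ψ
      (ih _)

end OracleCircuit

/-! ### Random matchings and the permutations exchanging them -/

section Embeddings

variable {X : Type*} [DecidableEq X]

lemma swap_apply_mem {A : Finset X} {a b x : X} (ha : a ∈ A) (hb : b ∈ A) (hx : x ∈ A) :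
    Equiv.swap a b x ∈ A := by
  rw [Equiv.swap_apply_def]
  split_ifs <;> assumption

lemma swap_apply_mem_of_disjoint {A B : Finset X} (h : Disjoint A B) {a b x : X} (ha : a ∈ A)
    (hb : b ∈ A) (hx : x ∈ B) : Equiv.swap a b x ∈ B := by
  rwa [Equiv.swap_apply_of_ne_of_ne]
  · rintro rfl
    exact Finset.disjoint_left.1 h ha hx
  · rintro rfl
    exact Finset.disjoint_left.1 h hb hx

/-- In a family of embeddings that is invariant under the permutations of `A`, all elements of
`A` are hit equally often. -/
lemma card_filter_hit_mul_card_le {ι : Type*} [Fintype ι] {κ : ℕ} {S : Finset (ι ↪ X)}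
    {A : Finset X}
    (hS : ∀ a ∈ A, ∀ b ∈ A, ∀ e ∈ S, e.trans (Equiv.swap a b).toEmbedding ∈ S)
    (hκ : ∀ e ∈ S, (A.filter fun b => ∃ i, e i = b).card ≤ κ) {a : X} (ha : a ∈ A) :
    (S.filter fun e => ∃ i, e i = a).card * A.card ≤ κ * S.card := by
  calc (S.filter fun e => ∃ i, e i = a).card * A.card
      = ∑ _b ∈ A, (S.filter fun e => ∃ i, e i = a).card := by
        rw [Finset.sum_const, smul_eq_mul, mul_comm]
    _ ≤ ∑ b ∈ A, (S.filter fun e => ∃ i, e i = b).card := Finset.sum_le_sum fun b hb =>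
        Finset.card_le_card_of_injOn (fun e => e.trans (Equiv.swap a b).toEmbedding)
          (fun e he => by
            obtain ⟨heS, i, hi⟩ := Finset.mem_filter.1 he
            refine Finset.mem_filter.2 ⟨hS a ha b hb e heS, i, ?_⟩
            simp [hi])
          (fun e _ e' _ hee => Function.Embedding.ext fun i =>
            (Equiv.swap a b).injective (DFunLike.congr_fun hee i))
    _ = ∑ e ∈ S, (A.filter fun b => ∃ i, e i = b).card :=
        (Finset.sum_card_bipartiteAbove_eq_sum_card_bipartiteBelow (s := A) (t := S)
          fun (b : X) (e : ι ↪ X) => ∃ i, e i = b :)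
    _ ≤ κ * S.card := by
        rw [mul_comm, ← smul_eq_mul, ← Finset.sum_const]
        exact Finset.sum_le_sum hκ

/-- The permutation that exchanges `e (inl i)` and `e (inr i)` for all `i`. -/
def exchange {κ : ℕ} (e : Fin κ ⊕ Fin κ ↪ X) : Equiv.Perm X :=
  Equiv.Perm.viaFintypeEmbedding (Equiv.sumComm (Fin κ) (Fin κ)) e

lemma exchange_inl {κ : ℕ} (e : Fin κ ⊕ Fin κ ↪ X) (i : Fin κ) :
    exchange e (e (Sum.inl i)) = e (Sum.inr i) :=
  Equiv.Perm.viaFintypeEmbedding_apply_image _ _ _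

lemma exchange_inr {κ : ℕ} (e : Fin κ ⊕ Fin κ ↪ X) (i : Fin κ) :
    exchange e (e (Sum.inr i)) = e (Sum.inl i) :=
  Equiv.Perm.viaFintypeEmbedding_apply_image _ _ _

lemma exchange_of_not_exists {κ : ℕ} (e : Fin κ ⊕ Fin κ ↪ X) {a : X} (ha : ¬∃ i, e i = a) :
    exchange e a = a :=
  Equiv.Perm.viaFintypeEmbedding_apply_notMem_range _ _ ha

variable [Fintype X]

/-- Pairs of injections of `Fin κ` into `A` and into `B`, with disjoint images. -/
noncomputable def sumEmbeddings (κ : ℕ) (A B : Finset X) : Finset (Fin κ ⊕ Fin κ ↪ X) :=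
  Finset.univ.filter fun e => (∀ i, e (Sum.inl i) ∈ A) ∧ ∀ i, e (Sum.inr i) ∈ B

lemma mem_sumEmbeddings {κ : ℕ} {A B : Finset X} {e : Fin κ ⊕ Fin κ ↪ X} :
    e ∈ sumEmbeddings κ A B ↔ (∀ i, e (Sum.inl i) ∈ A) ∧ ∀ i, e (Sum.inr i) ∈ B := by
  simp [sumEmbeddings]

lemma card_sumEmbeddings (κ : ℕ) {A B : Finset X} (h : Disjoint A B) :
    (sumEmbeddings κ A B).card = A.card.descFactorial κ * B.card.descFactorial κ := by
  have hcard : ∀ A : Finset X, A.card.descFactorial κ = Fintype.card (Fin κ ↪ A) := fun A => by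
    rw [Fintype.card_embedding_eq, Fintype.card_coe, Fintype.card_fin]
  rw [hcard, hcard, ← Fintype.card_prod, ← Fintype.card_coe]
  refine Fintype.card_congr
    { toFun := fun e =>
        (⟨fun i => ⟨e.1 (Sum.inl i), (mem_sumEmbeddings.1 e.2).1 i⟩, fun i j hij =>
          Sum.inl_injective (e.1.injective (congrArg Subtype.val hij))⟩,
        ⟨fun i => ⟨e.1 (Sum.inr i), (mem_sumEmbeddings.1 e.2).2 i⟩, fun i j hij =>
          Sum.inr_injective (e.1.injective (congrArg Subtype.val hij))⟩)
      invFun := fun p => ⟨⟨Sum.elim (fun i => (p.1 i : X)) (fun i => (p.2 i : X)),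
        (Subtype.val_injective.comp p.1.injective).sumElim
          (Subtype.val_injective.comp p.2.injective)
          fun i j hij => Finset.disjoint_left.1 h (p.1 i).2
            (by have := (p.2 j).2; rwa [← show (p.1 i : X) = p.2 j from hij] at this)⟩,
        mem_sumEmbeddings.2 ⟨fun i => (p.1 i).2, fun i => (p.2 i).2⟩⟩
      left_inv := fun e => Subtype.ext (Function.Embedding.ext fun i => by cases i <;> rfl)
      right_inv := fun p => rfl }

/-- A point lies in at most one of A and B. Swaps inside that set preserve the family, and each e
hits at most κ of its N points. -/
lemma card_sumEmbeddings_hit_le (κ : ℕ) {A B : Finset X} (h : Disjoint A B) {N : ℕ}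
    (hA : A.card = N) (hB : B.card = N) (a : X) :
    ((sumEmbeddings κ A B).filter fun e => ∃ i, e i = a).card * N ≤
      κ * (sumEmbeddings κ A B).card := by
  by_cases haA : a ∈ A
  · conv_lhs => rw [← hA]
    refine card_filter_hit_mul_card_le (fun a ha b hb e he => ?_) (fun e he => ?_) haA
    · rw [mem_sumEmbeddings] at he ⊢
      exact ⟨fun i => swap_apply_mem ha hb (he.1 i),
        fun i => swap_apply_mem_of_disjoint h ha hb (he.2 i)⟩
    · rw [mem_sumEmbeddings] at he
      refine (Finset.card_le_card (t := Finset.univ.image fun i => e (Sum.inl i)) ?_).trans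
        (Finset.card_image_le.trans_eq (Finset.card_fin κ))
      intro b hb
      obtain ⟨hbA, i | i, rfl⟩ := Finset.mem_filter.1 hb
      · exact Finset.mem_image_of_mem _ (Finset.mem_univ i)
      · exact absurd (he.2 i) (Finset.disjoint_left.1 h hbA)
  by_cases haB : a ∈ B
  · conv_lhs => rw [← hB]
    refine card_filter_hit_mul_card_le (fun a ha b hb e he => ?_) (fun e he => ?_) haB
    · rw [mem_sumEmbeddings] at he ⊢
      exact ⟨fun i => swap_apply_mem_of_disjoint h.symm ha hb (he.1 i),
        fun i => swap_apply_mem ha hb (he.2 i)⟩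
    · rw [mem_sumEmbeddings] at he
      refine (Finset.card_le_card (t := Finset.univ.image fun i => e (Sum.inr i)) ?_).trans
        (Finset.card_image_le.trans_eq (Finset.card_fin κ))
      intro b hb
      obtain ⟨hbB, i | i, rfl⟩ := Finset.mem_filter.1 hb
      · exact absurd hbB (Finset.disjoint_left.1 h (he.1 i))
      · exact Finset.mem_image_of_mem _ (Finset.mem_univ i)
  · rw [Finset.filter_false_of_mem]
    · simp
    · rintro e he ⟨i | i, rfl⟩
      · exact haA ((mem_sumEmbeddings.1 he).1 i)
      · exact haB ((mem_sumEmbeddings.1 he).2 i)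

end Embeddings

/-! ### Creating zero pairs by exchanging preimages -/

section ZeroPairs

/-- The strings of the form `x || 0^n`. -/
def zeroBlock (n : ℕ) : Finset (BitString (n + n)) :=
  Finset.univ.image fun x : BitString n => Fin.append x (0 : BitString n)

lemma mem_zeroBlock {n : ℕ} {a : BitString (n + n)} :
    a ∈ zeroBlock n ↔ ∃ x : BitString n, Fin.append x (0 : BitString n) = a := by
  simp [zeroBlock]

lemma append_zero_injective (n : ℕ) :
    Function.Injective fun x : BitString n => Fin.append x (0 : BitString n) := fun x y h => by
  funext i
  simpa using congrFun h (Fin.castAdd n i)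

lemma card_zeroBlock (n : ℕ) : (zeroBlock n).card = 2 ^ n := by
  rw [zeroBlock, Finset.card_image_of_injective _ (append_zero_injective n)]
  simp

/-- The first components of the zero pairs of `φ`. -/
def zeroInputs {n : ℕ} (φ : Equiv.Perm (BitString (n + n))) : Finset (BitString (n + n)) :=
  (zeroBlock n).filter fun a => φ a ∈ zeroBlock n

lemma mem_zeroInputs {n : ℕ} {φ : Equiv.Perm (BitString (n + n))} {a : BitString (n + n)} :
    a ∈ zeroInputs φ ↔ a ∈ zeroBlock n ∧ φ a ∈ zeroBlock n := Finset.mem_filter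

lemma card_zeroInputs {n : ℕ} (φ : Equiv.Perm (BitString (n + n))) :
    (zeroInputs φ).card = numZeroPairs φ := by
  symm
  refine Finset.card_bij (fun p _ => Fin.append p.1 (0 : BitString n)) ?_ ?_ ?_
  · intro p hp
    exact mem_zeroInputs.2 ⟨mem_zeroBlock.2 ⟨p.1, rfl⟩,
      mem_zeroBlock.2 ⟨p.2, (Finset.mem_filter.1 hp).2.symm⟩⟩
  · intro p hp q hq h
    have h1 : p.1 = q.1 := append_zero_injective n h
    refine Prod.ext h1 (append_zero_injective n ?_)
    have hp := (Finset.mem_filter.1 hp).2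
    have hq := (Finset.mem_filter.1 hq).2
    simp only
    rw [← hp, ← hq, h1]
  · intro a ha
    obtain ⟨hx, hy⟩ := mem_zeroInputs.1 ha
    obtain ⟨x, rfl⟩ := mem_zeroBlock.1 hx
    obtain ⟨y, hy⟩ := mem_zeroBlock.1 hy
    exact ⟨(x, y), Finset.mem_filter.2 ⟨Finset.mem_univ _, hy.symm⟩, rfl⟩

lemma mem_permsWithZeroPairs {n κ : ℕ} {φ : Equiv.Perm (BitString (n + n))} :
    φ ∈ permsWithZeroPairs n κ ↔ (zeroInputs φ).card = κ := by
  rw [card_zeroInputs]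
  simp [permsWithZeroPairs]

lemma mem_permsWithZeroPairs_zero {n : ℕ} {φ : Equiv.Perm (BitString (n + n))} :
    φ ∈ permsWithZeroPairs n 0 ↔ ∀ a ∈ zeroBlock n, φ a ∉ zeroBlock n := by
  rw [mem_permsWithZeroPairs, Finset.card_eq_zero, Finset.eq_empty_iff_forall_notMem]
  simp only [mem_zeroInputs, not_and]

lemma permsWithZeroPairs_zero_nonempty {n : ℕ} (hn : 0 < n) :
    (permsWithZeroPairs n 0).Nonempty := by
  -- Adding the all-ones string flips the second half, which is nonempty as n ≥ 1.
  refine ⟨Equiv.addRight (fun _ => 1), mem_permsWithZeroPairs_zero.2 fun a ha hb => ?_⟩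
  obtain ⟨x, rfl⟩ := mem_zeroBlock.1 ha
  obtain ⟨y, hy⟩ := mem_zeroBlock.1 hb
  have h : Fin.append y (0 : BitString n) (Fin.natAdd n ⟨0, hn⟩) =
    Fin.append x (0 : BitString n) (Fin.natAdd n ⟨0, hn⟩) + 1 := congrFun hy _
  have ha : Fin.append x (0 : BitString n) (Fin.natAdd n ⟨0, hn⟩) = 0 := Fin.append_right _ _ _
  have hb : Fin.append y (0 : BitString n) (Fin.natAdd n ⟨0, hn⟩) = 0 := Fin.append_right _ _ _
  rw [ha, hb] at h
  exact absurd h (by decide)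

/-- The inputs that `φ` maps into the zero block. -/
def zeroPreimages {n : ℕ} (φ : Equiv.Perm (BitString (n + n))) : Finset (BitString (n + n)) :=
  Finset.univ.filter fun a => φ a ∈ zeroBlock n

lemma mem_zeroPreimages {n : ℕ} {φ : Equiv.Perm (BitString (n + n))} {a : BitString (n + n)} :
    a ∈ zeroPreimages φ ↔ φ a ∈ zeroBlock n := by
  simp [zeroPreimages]

lemma card_zeroPreimages {n : ℕ} (φ : Equiv.Perm (BitString (n + n))) :
    (zeroPreimages φ).card = 2 ^ n := by
  rw [← card_zeroBlock, ← Finset.card_map φ.symm.toEmbedding (s := zeroBlock n)]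
  congr 1
  ext a
  simp [mem_zeroPreimages, Finset.mem_map_equiv]

/-- The inputs outside the zero block whose image is outside the zero block. -/
def nonzeroInputs {n : ℕ} (φ : Equiv.Perm (BitString (n + n))) : Finset (BitString (n + n)) :=
  (zeroBlock n ∪ zeroPreimages φ)ᶜ

lemma mem_nonzeroInputs {n : ℕ} {φ : Equiv.Perm (BitString (n + n))} {a : BitString (n + n)} :
    a ∈ nonzeroInputs φ ↔ a ∉ zeroBlock n ∧ φ a ∉ zeroBlock n := by
  simp [nonzeroInputs, mem_zeroPreimages]

lemma card_nonzeroInputs {n : ℕ} (φ : Equiv.Perm (BitString (n + n))) :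
    (nonzeroInputs φ).card = 2 ^ (n + n) - (2 ^ n + 2 ^ n - (zeroInputs φ).card) := by
  have hi : zeroInputs φ = zeroBlock n ∩ zeroPreimages φ := by
    ext a
    rw [Finset.mem_inter, mem_zeroInputs, mem_zeroPreimages]
  rw [nonzeroInputs, Finset.card_compl, Finset.card_union, card_zeroBlock, card_zeroPreimages,
    ← hi]
  simp

lemma disjoint_zeroInputs_nonzeroInputs {n : ℕ} (φ : Equiv.Perm (BitString (n + n))) :
    Disjoint (zeroInputs φ) (nonzeroInputs φ) :=
  Finset.disjoint_left.2 fun _ h h' => (mem_nonzeroInputs.1 h').1 (mem_zeroInputs.1 h).1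

lemma disjoint_zeroBlock_zeroPreimages {n : ℕ} {φ : Equiv.Perm (BitString (n + n))}
    (hφ : φ ∈ permsWithZeroPairs n 0) : Disjoint (zeroBlock n) (zeroPreimages φ) :=
  Finset.disjoint_left.2 fun a h h' =>
    mem_permsWithZeroPairs_zero.1 hφ a h (mem_zeroPreimages.1 h')

/-- Exchanging the preimages turns a permutation without zero pairs into one with `κ` zero
pairs. -/
lemma mul_exchange_mem_iff {n κ : ℕ} (φ : Equiv.Perm (BitString (n + n)))
    (e : Fin κ ⊕ Fin κ ↪ BitString (n + n)) :
    (φ ∈ permsWithZeroPairs n 0 ∧ e ∈ sumEmbeddings κ (zeroBlock n) (zeroPreimages φ)) ↔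
      (φ * exchange e ∈ permsWithZeroPairs n κ ∧
        e ∈ sumEmbeddings κ (zeroInputs (φ * exchange e)) (nonzeroInputs (φ * exchange e))) := by
  have hl : ∀ i, (φ * exchange e) (e (Sum.inl i)) = φ (e (Sum.inr i)) := fun i => by
    rw [Equiv.Perm.mul_apply, exchange_inl]
  have hr : ∀ i, (φ * exchange e) (e (Sum.inr i)) = φ (e (Sum.inl i)) := fun i => by
    rw [Equiv.Perm.mul_apply, exchange_inr]
  have ho : ∀ a, (¬∃ i, e i = a) → (φ * exchange e) a = φ a := fun a ha => by
    rw [Equiv.Perm.mul_apply, exchange_of_not_exists e ha]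
  have hcard : (Finset.univ.image fun i => e (Sum.inl i)).card = κ := by
    rw [Finset.card_image_of_injective _ fun i j hij => Sum.inl_injective (e.injective hij),
      Finset.card_univ, Fintype.card_fin]
  rw [mem_permsWithZeroPairs_zero, mem_permsWithZeroPairs]
  simp only [mem_sumEmbeddings, mem_zeroPreimages, mem_zeroInputs, mem_nonzeroInputs, hl, hr]
  constructor
  · rintro ⟨h0, hA, hB⟩
    have hB' : ∀ i, e (Sum.inr i) ∉ zeroBlock n := fun i h => h0 _ h (hB i)
    refine ⟨?_, fun i => ⟨hA i, hB i⟩, fun i => ⟨hB' i, h0 _ (hA i)⟩⟩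
    refine Eq.trans (congrArg Finset.card ?_) hcard
    ext a
    simp only [mem_zeroInputs, Finset.mem_image, Finset.mem_univ, true_and]
    constructor
    · rintro ⟨ha, ha'⟩
      by_cases h : ∃ i, e i = a
      · obtain ⟨i | i, rfl⟩ := h
        · exact ⟨i, rfl⟩
        · exact absurd ha (hB' i)
      · rw [ho a h] at ha'
        exact absurd ha' (h0 a ha)
    · rintro ⟨i, rfl⟩
      rw [hl]
      exact ⟨hA i, hB i⟩
  · rintro ⟨hκ, hA, hB⟩
    -- The κ distinct points `e (inl i)` exhaust the zero inputs of the exchanged permutation, so φ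
    -- has no zero pair away from e.
    have himage : (Finset.univ.image fun i => e (Sum.inl i)) = zeroInputs (φ * exchange e) := by
      refine Finset.eq_of_subset_of_card_le (fun a ha => ?_) (by rw [hκ, hcard])
      obtain ⟨i, -, rfl⟩ := Finset.mem_image.1 ha
      rw [mem_zeroInputs, hl]
      exact hA i
    refine ⟨fun a ha ha' => ?_, fun i => (hA i).1, fun i => (hA i).2⟩
    by_cases h : ∃ i, e i = a
    · obtain ⟨i | i, rfl⟩ := h
      · exact (hB i).2 ha'
      · exact (hB i).1 ha
    · have hmem : a ∈ zeroInputs (φ * exchange e) := mem_zeroInputs.2 ⟨ha, by rwa [ho a h]⟩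
      rw [← himage] at hmem
      obtain ⟨i, -, hi⟩ := Finset.mem_image.1 hmem
      exact h ⟨_, hi⟩

/-- Exchanging the preimages of a uniformly random permutation without zero pairs gives a
uniformly random permutation with `κ` zero pairs, up to normalisation. -/
lemma sum_sum_mul_exchange (n κ : ℕ) (F : Equiv.Perm (BitString (n + n)) → ℝ) :
    ∑ φ ∈ permsWithZeroPairs n 0, ∑ e ∈ sumEmbeddings κ (zeroBlock n) (zeroPreimages φ),
        F (φ * exchange e) =
      ((κ.descFactorial κ * (2 ^ (n + n) - (2 ^ n + 2 ^ n - κ)).descFactorial κ : ℕ) : ℝ) *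
        ∑ φ ∈ permsWithZeroPairs n κ, F φ := by
  classical
  have hright : ∀ φ ∈ permsWithZeroPairs n κ,
      ∑ e ∈ sumEmbeddings κ (zeroInputs φ) (nonzeroInputs φ), F φ =
      ((κ.descFactorial κ * (2 ^ (n + n) - (2 ^ n + 2 ^ n - κ)).descFactorial κ : ℕ) : ℝ) *
        F φ := fun φ hφ => by
    rw [Finset.sum_const, card_sumEmbeddings κ (disjoint_zeroInputs_nonzeroInputs φ),
      card_nonzeroInputs, mem_permsWithZeroPairs.1 hφ, nsmul_eq_mul]
  have hsum : ∀ (P : Finset (Equiv.Perm (BitString (n + n))))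
      (S : Equiv.Perm (BitString (n + n)) → Finset (Fin κ ⊕ Fin κ ↪ BitString (n + n)))
      (G : Equiv.Perm (BitString (n + n)) → (Fin κ ⊕ Fin κ ↪ BitString (n + n)) → ℝ),
      ∑ φ ∈ P, ∑ e ∈ S φ, G φ e = ∑ e, ∑ φ, if φ ∈ P ∧ e ∈ S φ then G φ e else 0 :=
    fun P S G => by
      rw [Finset.sum_comm]
      simp only [ite_and, Finset.sum_ite_mem, Finset.univ_inter, Finset.sum_ite_irrel,
        Finset.sum_const_zero]
  rw [Finset.mul_sum, ← Finset.sum_congr rfl hright, hsum, hsum]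
  refine Finset.sum_congr rfl fun e _ => ?_
  -- For fixed e, right multiplication by `exchange e` permutes the whole symmetric group and
  -- matches the two side conditions.
  conv_rhs => rw [← Equiv.sum_comp (Equiv.mulRight (exchange e))]
  refine Finset.sum_congr rfl fun φ _ => if_congr (mul_exchange_mem_iff φ e) rfl rfl

end ZeroPairs

/-! ### The distinguishing bound -/

theorem mainTheorem5 (n : ℕ) (hn : 0 < n) (κ : ℕ) (hκ : κ ≤ 2 ^ n) (T : ℕ)
    {E : Type*} [Fintype E] (D : Distinguisher n E) (hD : D.MakesAtMost T) :
    |D.avgProb κ - D.avgProb 0| ≤ 2 * (T : ℝ) * Real.sqrt ((κ : ℝ) / 2 ^ n) := by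
  set δ : ℝ := Real.sqrt ((κ : ℝ) / 2 ^ n) with hδ
  have hδ0 : 0 ≤ δ := Real.sqrt_nonneg _
  have hδsq : δ ^ 2 = κ / 2 ^ n := Real.sq_sqrt (by positivity)
  set P := permsWithZeroPairs n 0 with hP
  set S := fun φ : Equiv.Perm (BitString (n + n)) =>
    sumEmbeddings κ (zeroBlock n) (zeroPreimages φ) with hS
  set M : ℕ := (2 ^ n).descFactorial κ * (2 ^ n).descFactorial κ with hM
  set c : ℕ := κ.descFactorial κ * (2 ^ (n + n) - (2 ^ n + 2 ^ n - κ)).descFactorial κ with hc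
  have hcardS : ∀ φ ∈ P, (S φ).card = M := fun φ hφ => by
    rw [hS, hM, card_sumEmbeddings κ (disjoint_zeroBlock_zeroPreimages hφ), card_zeroBlock,
      card_zeroPreimages]
  have hMpos : (0 : ℝ) < M := by
    have := Nat.descFactorial_pos.2 hκ
    exact_mod_cast Nat.mul_pos this this
  have hPpos : (0 : ℝ) < P.card := by
    exact_mod_cast (permsWithZeroPairs_zero_nonempty hn).card_pos
  have hcount : (P.card : ℝ) * M = c * (permsWithZeroPairs n κ).card := by
    have h := sum_sum_mul_exchange n κ fun _ => 1
    simp only [Finset.sum_const, nsmul_eq_mul, mul_one] at h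
    rw [← h, Finset.sum_congr rfl fun φ hφ => congrArg (Nat.cast (R := ℝ)) (hcardS φ hφ),
      Finset.sum_const, nsmul_eq_mul]
  -- The double count forces c ≠ 0, with no need to compare κ with the number of nonzero inputs.
  have hcpos : (0 : ℝ) < c := by
    refine lt_of_le_of_ne (Nat.cast_nonneg _) fun h => ?_
    rw [← h, zero_mul] at hcount
    exact (mul_pos hPpos hMpos).ne' hcount
  have havg : D.avgProb κ = (∑ φ ∈ P, ∑ e ∈ S φ, D.prob (φ * exchange e)) / (P.card * M) := by
    rw [hcount, sum_sum_mul_exchange n κ D.prob, mul_div_mul_left _ _ hcpos.ne']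
    rfl
  have havg0 : D.avgProb 0 = (∑ φ ∈ P, ∑ e ∈ S φ, D.prob φ) / (P.card * M) := by
    rw [Finset.sum_congr rfl fun φ hφ => by rw [Finset.sum_const, hcardS φ hφ, nsmul_eq_mul],
      ← Finset.mul_sum, mul_comm (P.card : ℝ), mul_div_mul_left _ _ hMpos.ne']
    rfl
  have hhit : ∀ φ ∈ P, ∀ (a : BitString (n + n)) (p : (Fin κ ⊕ Fin κ ↪ BitString (n + n)) → Prop) [DecidablePred p],
      (∀ e, p e → ∃ i, e i = a) →
      (((S φ).filter p).card : ℝ) ≤ δ ^ 2 * (S φ).card := fun φ hφ a p _ hp => by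
    have h := card_sumEmbeddings_hit_le κ (disjoint_zeroBlock_zeroPreimages hφ)
      (card_zeroBlock n) (card_zeroPreimages φ) a
    have h' := (Nat.mul_le_mul_right (2 ^ n) (Finset.card_le_card
      (Finset.monotone_filter_right (S φ) fun e _ => hp e))).trans h
    rw [hδsq, div_mul_eq_mul_div, le_div_iff₀ (by positivity)]
    exact_mod_cast h'
  have hmain : ∀ φ ∈ P, |∑ e ∈ S φ, (D.prob (φ * exchange e) - D.prob φ)| ≤ 2 * T * δ * M :=
    fun φ hφ => by
      refine (Finset.abs_sum_le_sum_abs _ _).trans ((OracleCircuit.sum_abs_outputOneProb_sub_le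
        (S φ) (fun e => φ * exchange e) φ hδ0 (fun a => hhit φ hφ a _ fun e he => ?_)
        (fun a => hhit φ hφ (φ.symm a) _ fun e he => ?_) D.circuit D.init).trans ?_)
      · by_contra h
        exact he (by rw [Equiv.Perm.mul_apply, exchange_of_not_exists e h])
      -- The inverse of φ ∘ π differs from φ⁻¹ at a only if π moves φ⁻¹(a).
      · by_contra h
        refine he ((Equiv.symm_apply_eq _).2 ?_)
        rw [Equiv.Perm.mul_apply, exchange_of_not_exists e h, Equiv.apply_symm_apply]
      · rw [D.norm_init, one_pow, mul_one, hcardS φ hφ]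
        have hT : (D.circuit.queryCount : ℝ) ≤ T := by exact_mod_cast hD
        nlinarith [mul_le_mul_of_nonneg_left hT (mul_nonneg hδ0 hMpos.le)]
  rw [havg, havg0, ← sub_div, ← Finset.sum_sub_distrib, abs_div, abs_of_pos (mul_pos hPpos hMpos),
    div_le_iff₀ (mul_pos hPpos hMpos)]
  calc |∑ φ ∈ P, (∑ e ∈ S φ, D.prob (φ * exchange e) - ∑ e ∈ S φ, D.prob φ)|
      ≤ ∑ φ ∈ P, |∑ e ∈ S φ, (D.prob (φ * exchange e) - D.prob φ)| := by
        simp only [Finset.sum_sub_distrib (s := S _)]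
        exact Finset.abs_sum_le_sum_abs _ _
    _ ≤ ∑ _φ ∈ P, 2 * T * δ * M := Finset.sum_le_sum hmain
    _ = _ := by
        rw [Finset.sum_const, nsmul_eq_mul]
        ring
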